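/- Let $K$ be a field and let $L$ be a finite-dimensional nilpotent Lie algebra over $K$. Write $L^2=[L,L]$, and let $\mathcal M(L)=(R\cap F^2)/[R,F]$ be its Schur multiplier, where $L\cong F/R$ with $F$ a free Lie algebra. Put $n=\dim L$, $m=\dim L^2$, and let $c$ be the nilpotency class of $L$. Say that $\dim\mathcal M(L)$ attains Rai's bound if $$\dim \mathcal M(L)=\tfrac12 (n-m-1)(n+m)-\sum_{i=2}^{\min\{n-m,\,c\}}(n-m-i).$$ Suppose that $c\ge 3$ and that $\dim\mathcal M(L)$ attains Rai's bound. Let $I$ be a one-dimensional ideal of $L$ contained in $Z(L)\cap L^2$. Then $\dim\mathcal M(L/I)$ attains Rai's bound for $L/I$; that is, with $n'=\dim L/I$, $m'=\dim (L/I)^2$ and $c'$ the nilpotency class of $L/I$, $$\dim \mathcal M(L/I)=\tfrac12 (n'-m'-1)(n'+m')-\sum_{i=2}^{\min\{n'-m',\,c'\}}(n'-m'-i).$$ -/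

import Mathlib

/-- The derived subalgebra `L² = [L, L]` of a Lie algebra, as an ideal. -/
def derivedIdeal (K L : Type*) [Field K] [LieRing L] [LieAlgebra K L] : LieIdeal K L :=
  ⁅(⊤ : LieIdeal K L), (⊤ : LieIdeal K L)⁆

/-- The canonical free presentation `F → L`: `F` is the free Lie algebra on the underlying set of
`L`, and each free generator is sent to the element of `L` that it names. -/
noncomputable def freePresentation (K L : Type*) [Field K] [LieRing L] [LieAlgebra K L] :
    FreeLieAlgebra K L →ₗ⁅K⁆ L :=
  FreeLieAlgebra.lift K (id : L → L)

theorem freePresentation_surjective (K L : Type*) [Field K] [LieRing L] [LieAlgebra K L] :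
    Function.Surjective (freePresentation K L) :=
  fun x => ⟨FreeLieAlgebra.of K x, FreeLieAlgebra.lift_of_apply (id : L → L) x⟩

/-- The ideal `R` of relations, the kernel of the free presentation, so that `L ≅ F / R`. -/
noncomputable def relationIdeal (K L : Type*) [Field K] [LieRing L] [LieAlgebra K L] :
    LieIdeal K (FreeLieAlgebra K L) :=
  (freePresentation K L).ker

/-- The Schur multiplier `M(L) = (R ∩ F²) / [R, F]` of a Lie algebra `L ≅ F / R`, `F` free, as a
vector space. -/
abbrev SchurMultiplier (K L : Type*) [Field K] [LieRing L] [LieAlgebra K L] : Type _ :=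
  (relationIdeal K L ⊓ derivedIdeal K (FreeLieAlgebra K L)).toSubmodule ⧸
    (⁅relationIdeal K L, (⊤ : LieIdeal K (FreeLieAlgebra K L))⁆.toSubmodule).submoduleOf
      (relationIdeal K L ⊓ derivedIdeal K (FreeLieAlgebra K L)).toSubmodule

/-- Rai's bound `(n - m - 1)(n + m) / 2 - ∑_{i = 2}^{min (n - m, c)} (n - m - i)`. It is used for
`m ≤ n` only, so that the subtraction of natural numbers in the range of summation is exact. -/
def raiBound (n m c : ℕ) : ℚ :=
  1 / 2 * ((n : ℚ) - m - 1) * ((n : ℚ) + m)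
    - ∑ i ∈ Finset.Icc 2 (min (n - m) c), ((n : ℚ) - m - i)

/-- The dimension of the Schur multiplier of `L` attains Rai's bound for the dimension of `L`, the
dimension of `L²` and the nilpotency class of `L`. -/
def AttainsRaiBound (K L : Type*) [Field K] [LieRing L] [LieAlgebra K L] : Prop :=
  Module.Finite K (SchurMultiplier K L) ∧
    (Module.finrank K (SchurMultiplier K L) : ℚ) =
      raiBound (Module.finrank K L) (Module.finrank K (derivedIdeal K L))
        (LieModule.nilpotencyLength L L)

/-! Call dim M(L) minus Rai's bound the defect of L. The defect is never positive
(`SchurMultiplier.finrank_le_raiBound`), and for class at least 2 it does not decrease in passing to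
L/I (`SchurMultiplier.central_extension`). Defect 0 for L therefore forces defect 0 for L/I.

For the monotonicity, write L = F/R and I = S/R. In the chain [R,F] ≤ [S,F] ≤ R ∩ F² ≤ S ∩ F², the
top quotient is isomorphic to I, so dim M(L) + 1 = dim M(L/I) + dim [S,F]/[R,F]. With z a preimage
of a generator of I, the last space consists of the classes of the [z,y]. Its dimension is at most n
- m, since [z,F²] ≤ [R,F]. If the class c of L exceeds that of L/I, then I is the last nonzero term
of the lower central series, z can be an iterated bracket of c elements, and the Jacobi identity
gives dimension at most c. The increment of Rai's bound is exactly one less than the resulting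
estimate: n - m - 1, or min(n - m, c) - 1 when the class rises.

The bound itself follows by induction on dim L from the same inequality, starting from abelian
algebras. -/

/-! ### Dimensions of subquotients of vector spaces -/

section Subquotients

variable {K V W : Type*} [Field K] [AddCommGroup V] [Module K V] [AddCommGroup W] [Module K W]

/-- The subquotient `P / (N ∩ P)` of a vector space. -/
abbrev Subquotient (P N : Submodule K V) : Type _ := P ⧸ N.submoduleOf P

theorem Subquotient.mk_eq_zero {P N : Submodule K V} {x : P} :
    (Submodule.Quotient.mk x : Subquotient P N) = 0 ↔ (x : V) ∈ N :=
  Submodule.Quotient.mk_eq_zero _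

theorem Subquotient.mk_eq_mk {P N : Submodule K V} {x y : P} :
    (Submodule.Quotient.mk x : Subquotient P N) = Submodule.Quotient.mk y ↔ (x : V) - y ∈ N :=
  Submodule.Quotient.eq _

theorem Submodule.submoduleOf_mapsTo {φ : V →ₗ[K] W} {P N : Submodule K V} {P' N' : Submodule K W}
    (hP : ∀ x ∈ P, φ x ∈ P') (hN : ∀ x ∈ N, φ x ∈ N') :
    N.submoduleOf P ≤ (N'.submoduleOf P').comap (φ.restrict hP) :=
  fun x hx => hN x hx

/-- The map of subquotients induced by a linear map. -/
def Subquotient.map (φ : V →ₗ[K] W) {P N : Submodule K V} {P' N' : Submodule K W}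
    (hP : ∀ x ∈ P, φ x ∈ P') (hN : ∀ x ∈ N, φ x ∈ N') : Subquotient P N →ₗ[K] Subquotient P' N' :=
  Submodule.mapQ _ _ (φ.restrict hP) (Submodule.submoduleOf_mapsTo hP hN)

theorem Subquotient.nonempty_linearEquiv {P N : Submodule K V} {P' N' : Submodule K W}
    (φ : V →ₗ[K] W) (ψ : W →ₗ[K] V)
    (hP : ∀ x ∈ P, φ x ∈ P') (hN : ∀ x ∈ N, φ x ∈ N')
    (hP' : ∀ x ∈ P', ψ x ∈ P) (hN' : ∀ x ∈ N', ψ x ∈ N)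
    (h : ∀ x ∈ P, ψ (φ x) - x ∈ N) (h' : ∀ x ∈ P', φ (ψ x) - x ∈ N') :
    Nonempty (Subquotient P N ≃ₗ[K] Subquotient P' N') := by
  refine ⟨LinearEquiv.ofLinearMap (Subquotient.map φ hP hN) (Subquotient.map ψ hP' hN') ?_ ?_⟩
  · refine Submodule.linearMap_qext _ (LinearMap.ext fun x => ?_)
    exact (Submodule.Quotient.eq _).2 (h' x x.2)
  · refine Submodule.linearMap_qext _ (LinearMap.ext fun x => ?_)
    exact (Submodule.Quotient.eq _).2 (h x x.2)

theorem Subquotient.map_id_injective {N P T : Submodule K V} (hPT : P ≤ T) :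
    Function.Injective (Subquotient.map (LinearMap.id : V →ₗ[K] V) (P := P) (N := N) (P' := T)
      (N' := N) (fun _ hx => hPT hx) (fun _ hx => hx)) := by
  rw [← LinearMap.ker_eq_bot, LinearMap.ker_eq_bot']
  intro x
  induction x using Submodule.Quotient.induction_on with
  | _ x =>
  intro hx
  exact mk_eq_zero.2 (mk_eq_zero (P := T) (x := ⟨x, hPT x.2⟩).1 hx)

theorem Subquotient.map_id_surjective {N P T : Submodule K V} (hNP : N ≤ P) :
    Function.Surjective (Subquotient.map (LinearMap.id : V →ₗ[K] V) (P := T) (N := N) (P' := T)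
      (N' := P) (fun _ hx => hx) (fun _ hx => hNP hx)) := by
  intro x
  induction x using Submodule.Quotient.induction_on with
  | _ x => exact ⟨Submodule.Quotient.mk x, rfl⟩

/-- Exactness in the middle of 0 → P/N → T/N → T/P → 0, from which finiteness and dimension add
along chains. -/
theorem Subquotient.exact {N P T : Submodule K V} (hNP : N ≤ P) (hPT : P ≤ T) :
    LinearMap.ker (Subquotient.map (LinearMap.id : V →ₗ[K] V) (P := T) (N := N) (P' := T)
      (N' := P) (fun _ hx => hx) (fun _ hx => hNP hx)) =
    LinearMap.range (Subquotient.map (LinearMap.id : V →ₗ[K] V) (P := P) (N := N) (P' := T)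
      (N' := N) (fun _ hx => hPT hx) (fun _ hx => hx)) := by
  ext x
  induction x using Submodule.Quotient.induction_on with
  | _ x =>
  constructor
  · intro hx
    have hx : (x : V) ∈ P := mk_eq_zero.1 hx
    exact ⟨Submodule.Quotient.mk ⟨x, hx⟩, rfl⟩
  · rintro ⟨y, hy⟩
    induction y using Submodule.Quotient.induction_on with
    | _ y =>
    have h : (y : V) - x ∈ N := (mk_eq_mk (P := T) (x := ⟨y, hPT y.2⟩)).1 hy
    refine (mk_eq_zero (P := T) (x := x)).2 ?_
    have := P.sub_mem y.2 (hNP h)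
    rwa [sub_sub_cancel] at this

theorem Subquotient.finite_iff {N P T : Submodule K V} (hNP : N ≤ P) (hPT : P ≤ T) :
    Module.Finite K (Subquotient T N) ↔
      Module.Finite K (Subquotient T P) ∧ Module.Finite K (Subquotient P N) := by
  constructor
  · intro _
    exact ⟨Module.Finite.of_surjective _ (map_id_surjective hNP),
      Module.Finite.of_injective _ (map_id_injective hPT)⟩
  · rintro ⟨h₁, h₂⟩
    have e := LinearMap.quotKerEquivOfSurjective _ (map_id_surjective (T := T) hNP)
    rw [exact hNP hPT] at e
    have := Module.Finite.equiv e.symm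
    exact Module.Finite.of_submodule_quotient (LinearMap.range (Subquotient.map
      (LinearMap.id : V →ₗ[K] V) (P := P) (N := N) (P' := T) (N' := N) (fun _ hx => hPT hx)
      (fun _ hx => hx)))

theorem Subquotient.finrank_add {N P T : Submodule K V} (hNP : N ≤ P) (hPT : P ≤ T)
    [Module.Finite K (Subquotient T N)] :
    Module.finrank K (Subquotient T N) =
      Module.finrank K (Subquotient T P) + Module.finrank K (Subquotient P N) := by
  have h := LinearMap.finrank_range_add_finrank_ker (Subquotient.map
    (LinearMap.id : V →ₗ[K] V) (P := T) (N := N) (P' := T) (N' := P) (fun _ hx => hx)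
    (fun _ hx => hNP hx))
  rw [exact hNP hPT, LinearMap.finrank_range_of_inj (map_id_injective hPT),
    LinearMap.range_eq_top.2 (map_id_surjective hNP), finrank_top] at h
  exact h.symm

theorem Subquotient.finite_and_finrank_le {ι : Type*} [Fintype ι] (v : ι → V)
    {P N : Submodule K V} (h : P ≤ N ⊔ Submodule.span K (Set.range v)) :
    Module.Finite K (Subquotient P N) ∧
      Module.finrank K (Subquotient P N) ≤ Fintype.card ι := by
  let A := Submodule.span K (Set.range fun i => N.mkQ (v i))
  have hA : ∀ x ∈ P, N.mkQ x ∈ A := by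
    intro x hx
    obtain ⟨a, ha, b, hb, rfl⟩ := Submodule.mem_sup.1 (h hx)
    have : N.mkQ a = 0 := (Submodule.Quotient.mk_eq_zero _).2 ha
    rw [map_add, this, zero_add]
    have h := Submodule.mem_map_of_mem (f := N.mkQ) hb
    rw [Submodule.map_span, ← Set.range_comp] at h
    exact h
  let φ : P →ₗ[K] A := N.mkQ.restrict hA
  have hφ : LinearMap.ker φ = N.submoduleOf P := by
    ext x
    rw [LinearMap.mem_ker, ← Subtype.coe_inj]
    exact Submodule.Quotient.mk_eq_zero _
  have inj : Function.Injective ((N.submoduleOf P).liftQ φ hφ.ge) := by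
    rw [← LinearMap.ker_eq_bot]
    exact Submodule.ker_liftQ_eq_bot _ _ _ hφ.le
  have : Module.Finite K A := Module.Finite.span_of_finite K (Set.finite_range _)
  exact ⟨Module.Finite.of_injective _ inj,
    (LinearMap.finrank_le_finrank_of_injective inj).trans (finrank_range_le_card _)⟩

theorem Subquotient.finrank_comap {P : Submodule K V} {Q : Submodule K W} (φ : V →ₗ[K] W)
    (hP : ∀ x ∈ P, φ x ∈ Q) (hQ : ∀ y ∈ Q, ∃ x ∈ P, φ x = y) :
    Nonempty (Subquotient P (LinearMap.ker φ ⊓ P) ≃ₗ[K] Q) := by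
  have hs : Function.Surjective (φ.restrict hP) := by
    rintro ⟨y, hy⟩
    obtain ⟨x, hx, rfl⟩ := hQ y hy
    exact ⟨⟨x, hx⟩, rfl⟩
  have hk : (LinearMap.ker φ ⊓ P).submoduleOf P = LinearMap.ker (φ.restrict hP) := by
    ext x
    rw [LinearMap.mem_ker, ← Subtype.coe_inj]
    exact ⟨fun h => h.1, fun h => ⟨h, x.2⟩⟩
  exact ⟨(Submodule.quotEquivOfEq _ _ hk).trans (LinearMap.quotKerEquivOfSurjective _ hs)⟩

end Subquotients

/-! ### Multipliers of presentations and their independence of the presentation -/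

section Brackets

variable {K F L G : Type*} [Field K] [LieRing F] [LieAlgebra K F] [LieRing L] [LieAlgebra K L]
  [LieRing G] [LieAlgebra K G]

/-- The multiplier `(R ∩ F²) / [R, F]` of a homomorphism with kernel `R`. -/
abbrev Multiplier (f : F →ₗ⁅K⁆ L) : Type _ :=
  Subquotient (f.ker ⊓ derivedIdeal K F).toSubmodule ⁅f.ker, (⊤ : LieIdeal K F)⁆.toSubmodule

theorem lie_top_le_of_forall {I : LieIdeal K F} {P : Submodule K F}
    (h : ∀ x ∈ I, ∀ y, ⁅x, y⁆ ∈ P) : ⁅I, (⊤ : LieIdeal K F)⁆.toSubmodule ≤ P := by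
  rw [LieSubmodule.lieIdeal_oper_eq_linear_span', Submodule.span_le]
  rintro _ ⟨x, hx, y, -, rfl⟩
  exact h x hx y

theorem lie_mem_lie_top {I : LieIdeal K F} {x : F} (hx : x ∈ I) (y : F) :
    ⁅x, y⁆ ∈ ⁅I, (⊤ : LieIdeal K F)⁆ :=
  LieSubmodule.lie_mem_lie hx (LieSubmodule.mem_top y)

theorem lie_mem_lie_top' {I : LieIdeal K F} {x : F} (hx : x ∈ I) (y : F) :
    ⁅y, x⁆ ∈ ⁅I, (⊤ : LieIdeal K F)⁆ := by
  rw [← lie_skew]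
  exact neg_mem (lie_mem_lie_top hx y)

theorem derivedIdeal_le_of_forall {P : Submodule K F} (h : ∀ x y : F, ⁅x, y⁆ ∈ P) :
    (derivedIdeal K F).toSubmodule ≤ P :=
  lie_top_le_of_forall fun x _ y => h x y

theorem lie_mem_derivedIdeal (x y : F) : ⁅x, y⁆ ∈ derivedIdeal K F :=
  lie_mem_lie_top (LieSubmodule.mem_top x) y

theorem map_mem_derivedIdeal (f : F →ₗ⁅K⁆ L) {x : F} (hx : x ∈ derivedIdeal K F) :
    f x ∈ derivedIdeal K L := by
  refine derivedIdeal_le_of_forall (P := (derivedIdeal K L).toSubmodule.comap (f : F →ₗ[K] L))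
    (fun x y => ?_) hx
  change f ⁅x, y⁆ ∈ derivedIdeal K L
  rw [LieHom.map_lie]
  exact lie_mem_derivedIdeal _ _

theorem exists_mem_derivedIdeal {f : F →ₗ⁅K⁆ L} (hf : Function.Surjective f) {y : L}
    (hy : y ∈ derivedIdeal K L) : ∃ x ∈ derivedIdeal K F, f x = y := by
  refine derivedIdeal_le_of_forall (P := (derivedIdeal K F).toSubmodule.map (f : F →ₗ[K] L))
    (fun x y => ?_) hy
  obtain ⟨x, rfl⟩ := hf x
  obtain ⟨y, rfl⟩ := hf y
  exact ⟨⁅x, y⁆, lie_mem_derivedIdeal _ _, LieHom.map_lie _ _ _⟩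

theorem map_mem_ker_inf_derivedIdeal {f : F →ₗ⁅K⁆ L} {g : G →ₗ⁅K⁆ L} {φ : F →ₗ⁅K⁆ G}
    (hφ : ∀ x, g (φ x) = f x) {x : F} (hx : x ∈ f.ker ⊓ derivedIdeal K F) :
    φ x ∈ g.ker ⊓ derivedIdeal K G :=
  ⟨LieHom.mem_ker.2 ((hφ x).trans (LieHom.mem_ker.1 hx.1)), map_mem_derivedIdeal φ hx.2⟩

theorem map_mem_ker_lie_top {f : F →ₗ⁅K⁆ L} {g : G →ₗ⁅K⁆ L} {φ : F →ₗ⁅K⁆ G}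
    (hφ : ∀ x, g (φ x) = f x) {x : F} (hx : x ∈ ⁅f.ker, (⊤ : LieIdeal K F)⁆) :
    φ x ∈ ⁅g.ker, (⊤ : LieIdeal K G)⁆ := by
  refine lie_top_le_of_forall
    (P := ⁅g.ker, (⊤ : LieIdeal K G)⁆.toSubmodule.comap (φ : F →ₗ[K] G)) (fun x hx y => ?_) hx
  change φ ⁅x, y⁆ ∈ ⁅g.ker, (⊤ : LieIdeal K G)⁆
  rw [LieHom.map_lie]
  refine lie_mem_lie_top ?_ _
  rw [LieHom.mem_ker, hφ]
  exact LieHom.mem_ker.1 hx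

/-- Since χ is the identity modulo R, changing one entry of a bracket at a time costs only elements
of [R,F]. Hence round trips between two presentations induce the identity on the multiplier. -/
theorem endomorphism_sub_mem_ker_lie_top {f : F →ₗ⁅K⁆ L} {χ : F →ₗ⁅K⁆ F}
    (hχ : ∀ x, f (χ x) = f x) {x : F} (hx : x ∈ derivedIdeal K F) :
    χ x - x ∈ ⁅f.ker, (⊤ : LieIdeal K F)⁆ := by
  have hker : ∀ x, χ x - x ∈ f.ker := fun x => by
    rw [LieHom.mem_ker, map_sub, hχ, sub_self]
  refine derivedIdeal_le_of_forall (P := ⁅f.ker, (⊤ : LieIdeal K F)⁆.toSubmodule.comap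
    ((χ : F →ₗ[K] F) - LinearMap.id)) (fun x y => ?_) hx
  change χ ⁅x, y⁆ - ⁅x, y⁆ ∈ ⁅f.ker, (⊤ : LieIdeal K F)⁆
  have : χ ⁅x, y⁆ - ⁅x, y⁆ = ⁅χ x - x, χ y⁆ + ⁅x, χ y - y⁆ := by
    rw [LieHom.map_lie, sub_lie, lie_sub]
    abel
  rw [this]
  exact add_mem (lie_mem_lie_top (hker x) _) (lie_mem_lie_top' (hker y) _)

/-- The multiplier does not depend on the choice among presentations that lift to one another. -/
theorem Multiplier.nonempty_linearEquiv {f : F →ₗ⁅K⁆ L} {g : G →ₗ⁅K⁆ L}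
    (φ : F →ₗ⁅K⁆ G) (ψ : G →ₗ⁅K⁆ F) (hφ : ∀ x, g (φ x) = f x) (hψ : ∀ x, f (ψ x) = g x) :
    Nonempty (Multiplier f ≃ₗ[K] Multiplier g) :=
  Subquotient.nonempty_linearEquiv (φ : F →ₗ[K] G) (ψ : G →ₗ[K] F)
    (fun _ hx => map_mem_ker_inf_derivedIdeal hφ hx) (fun _ hx => map_mem_ker_lie_top hφ hx)
    (fun _ hx => map_mem_ker_inf_derivedIdeal hψ hx) (fun _ hx => map_mem_ker_lie_top hψ hx)
    (fun _ hx => endomorphism_sub_mem_ker_lie_top (χ := ψ.comp φ)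
      (fun x => (hψ _).trans (hφ x)) hx.2)
    (fun _ hx => endomorphism_sub_mem_ker_lie_top (χ := φ.comp ψ)
      (fun x => (hφ _).trans (hψ x)) hx.2)

theorem FreeLieAlgebra.exists_lift {X : Type*} (f : FreeLieAlgebra K X →ₗ⁅K⁆ L) {g : G →ₗ⁅K⁆ L}
    (hg : Function.Surjective g) :
    ∃ φ : FreeLieAlgebra K X →ₗ⁅K⁆ G, ∀ x, g (φ x) = f x := by
  refine ⟨FreeLieAlgebra.lift K fun x => (hg (f (FreeLieAlgebra.of K x))).choose, fun x => ?_⟩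
  refine LieHom.congr_fun (FreeLieAlgebra.hom_ext (F₁ := g.comp (FreeLieAlgebra.lift K _))
    fun x => ?_) x
  rw [LieHom.comp_apply, FreeLieAlgebra.lift_of_apply]
  exact (hg (f (FreeLieAlgebra.of K x))).choose_spec

/-- This allows M(L/I) to be computed from the composite F → L → L/I, with the same F as for L. -/
theorem SchurMultiplier.nonempty_linearEquiv {X : Type*} {f : FreeLieAlgebra K X →ₗ⁅K⁆ L}
    (hf : Function.Surjective f) : Nonempty (Multiplier f ≃ₗ[K] SchurMultiplier K L) := by
  obtain ⟨φ, hφ⟩ := FreeLieAlgebra.exists_lift f (freePresentation_surjective K L)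
  obtain ⟨ψ, hψ⟩ := FreeLieAlgebra.exists_lift (freePresentation K L) hf
  exact Multiplier.nonempty_linearEquiv φ ψ hφ hψ

end Brackets

/-! ### Multipliers of abelian Lie algebras -/

section Abelian

variable {K F L : Type*} [Field K] [LieRing F] [LieAlgebra K F] [LieRing L] [LieAlgebra K L]

theorem lie_mem_of_basis {ι : Type*} {f : F →ₗ⁅K⁆ L} (b : Module.Basis ι K L) {u : ι → F}
    (hu : ∀ i, f (u i) = b i) (y : F) : y ∈ Submodule.span K (Set.range u) ⊔ f.ker.toSubmodule := by
  have : f y ∈ (Submodule.span K (Set.range u)).map (f : F →ₗ[K] L) := by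
    rw [Submodule.map_span, ← Set.range_comp]
    have h : ⇑(f : F →ₗ[K] L) ∘ u = b := funext hu
    rw [h, b.span_eq]
    trivial
  obtain ⟨x, hx, hxy⟩ := this
  refine Submodule.mem_sup.2 ⟨x, hx, y - x, ?_, add_sub_cancel _ _⟩
  change y - x ∈ f.ker
  rw [LieHom.mem_ker, map_sub, sub_eq_zero]
  exact hxy.symm

/-- The multiplier of an abelian Lie algebra of dimension `n` has dimension at most `n(n-1)/2`. -/
theorem Multiplier.finrank_le_of_abelian [FiniteDimensional K L] [IsLieAbelian L]
    {f : F →ₗ⁅K⁆ L} (hf : Function.Surjective f) :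
    Module.Finite K (Multiplier f) ∧ Module.finrank K (Multiplier f) ≤
      Module.finrank K L * (Module.finrank K L - 1) / 2 := by
  set n := Module.finrank K L
  let b := Module.finBasis K L
  choose u hu using fun i => hf (b i)
  -- One bracket for each pair i < j; the index type has ∑ j = n(n-1)/2 elements.
  let v : (Σ j : Fin n, Fin j) → F := fun p => ⁅u ⟨p.2, p.2.2.trans p.1.2⟩, u p.1⁆
  set Q := ⁅f.ker, (⊤ : LieIdeal K F)⁆.toSubmodule ⊔ Submodule.span K (Set.range v) with hQ
  have hlt : ∀ i j : Fin n, i < j → ⁅u i, u j⁆ ∈ Q := fun i j hij =>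
    Submodule.mem_sup_right (Submodule.subset_span ⟨⟨j, ⟨i, hij⟩⟩, rfl⟩)
  have huu : ∀ i j, ⁅u i, u j⁆ ∈ Q := by
    intro i j
    rcases lt_trichotomy i j with h | rfl | h
    · exact hlt i j h
    · rw [lie_self]
      exact Q.zero_mem
    · rw [← lie_skew]
      exact Q.neg_mem (hlt j i h)
  have hker : ∀ x ∈ f.ker, ∀ y : F, ⁅x, y⁆ ∈ Q := fun x hx y =>
    Submodule.mem_sup_left (lie_mem_lie_top hx y)
  have hux : ∀ i (y : F), ⁅u i, y⁆ ∈ Q := by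
    intro i y
    obtain ⟨a, ha, r, hr, rfl⟩ := Submodule.mem_sup.1 (lie_mem_of_basis b hu y)
    rw [lie_add]
    refine Q.add_mem ?_ ?_
    · have : Submodule.span K (Set.range u) ≤ Q.comap (LieAlgebra.ad K F (u i)) := by
        rw [Submodule.span_le]
        rintro _ ⟨j, rfl⟩
        exact huu i j
      exact this ha
    · rw [← lie_skew]
      exact Q.neg_mem (hker r hr _)
  have hall : ∀ x y : F, ⁅x, y⁆ ∈ Q := by
    intro x y
    obtain ⟨a, ha, r, hr, rfl⟩ := Submodule.mem_sup.1 (lie_mem_of_basis b hu x)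
    rw [add_lie]
    refine Q.add_mem ?_ (hker r hr _)
    have : Submodule.span K (Set.range u) ≤ Q.comap (LieAlgebra.ad K F y) := by
      rw [Submodule.span_le]
      rintro _ ⟨j, rfl⟩
      change ⁅y, u j⁆ ∈ Q
      rw [← lie_skew]
      exact Q.neg_mem (hux j y)
    rw [← lie_skew]
    exact Q.neg_mem (this ha)
  have h := Subquotient.finite_and_finrank_le v
    (P := (f.ker ⊓ derivedIdeal K F).toSubmodule) (N := ⁅f.ker, (⊤ : LieIdeal K F)⁆.toSubmodule)
    (fun x hx => derivedIdeal_le_of_forall hall hx.2)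
  rw [Fintype.card_sigma] at h
  simp only [Fintype.card_fin] at h
  rwa [Fin.sum_univ_eq_sum_range (fun i => i), Finset.sum_range_id] at h

end Abelian

open LieModule

/-! ### Lower central series, iterated brackets and nilpotency class -/

section LowerCentralSeries

variable {K F L L' : Type*} [Field K] [LieRing F] [LieAlgebra K F] [LieRing L] [LieAlgebra K L]
  [LieRing L'] [LieAlgebra K L']

/-- The span of the brackets `⁅x, w⁆` with `x` in `X` and `w` in the `m`-th term of the lower
central series. -/
def bracketSpan (K : Type*) {F : Type*} [Field K] [LieRing F] [LieAlgebra K F] (X : Set F)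
    (m : ℕ) : Submodule K F :=
  Submodule.span K {y | ∃ x ∈ X, ∃ w ∈ lowerCentralSeries K F F m, ⁅x, w⁆ = y}

theorem bracketSpan_le (X : Set F) (m : ℕ) :
    bracketSpan K X m ≤ (lowerCentralSeries K F F (m + 1)).toSubmodule := by
  refine Submodule.span_le.2 ?_
  rintro _ ⟨x, -, w, hw, rfl⟩
  change ⁅x, w⁆ ∈ lowerCentralSeries K F F (m + 1)
  rw [lowerCentralSeries_succ]
  exact LieSubmodule.lie_mem_lie (LieSubmodule.mem_top x) hw

theorem bracketSpan_mono {X Y : Set F} (h : X ⊆ Y) (m : ℕ) :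
    bracketSpan K X m ≤ bracketSpan K Y m :=
  Submodule.span_mono fun _ ⟨x, hx, w, hw, e⟩ => ⟨x, h hx, w, hw, e⟩

/-- The `k`-th term of the lower central series is spanned by elements (the left-normed brackets of
`k + 1` elements) whose brackets are controlled by the `k + 1` elements involved. -/
theorem lowerCentralSeries_le_span_controlled (k : ℕ) :
    (lowerCentralSeries K F F k).toSubmodule ≤ Submodule.span K
      {v | v ∈ lowerCentralSeries K F F k ∧ ∃ X : Finset F, X.card ≤ k + 1 ∧
        ∀ j, ∀ y ∈ lowerCentralSeries K F F j, ⁅y, v⁆ ∈ bracketSpan K (X : Set F) (j + k)} := by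
  classical
  induction k with
  | zero =>
    intro v _
    refine Submodule.subset_span ⟨LieSubmodule.mem_top v, {v}, by simp, fun j y hy => ?_⟩
    rw [← lie_skew]
    exact Submodule.neg_mem _ (Submodule.subset_span ⟨v, by simp, y, hy, rfl⟩)
  | succ k ih =>
    rw [lowerCentralSeries_succ, LieSubmodule.lieIdeal_oper_eq_linear_span', Submodule.span_le]
    rintro _ ⟨x, -, w, hw, rfl⟩
    refine (Submodule.span_le (p := Submodule.comap (LieAlgebra.ad K F x) (Submodule.span K _))).2
      ?_ (ih hw)
    rintro v ⟨hv, X, hX, h⟩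
    refine Submodule.subset_span ⟨?_, insert x X, ?_, fun j y hy => ?_⟩
    · exact LieSubmodule.lie_mem_lie (LieSubmodule.mem_top x) hv
    · exact (Finset.card_insert_le x X).trans (Nat.succ_le_succ hX)
    · change ⁅y, ⁅x, v⁆⁆ ∈ _
      -- Jacobi: ⁅y, ⁅x, v⁆⁆ = ⁅⁅y, x⁆, v⁆ + ⁅x, ⁅y, v⁆⁆. In the first term ⁅y, x⁆ lies one step
      -- deeper, which is why the induction hypothesis is needed for every j; the second only adds x
      -- to X.
      rw [leibniz_lie]
      refine Submodule.add_mem _ ?_ (Submodule.subset_span ⟨x, by simp, ⁅y, v⁆, ?_, rfl⟩)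
      · have hyx : ⁅y, x⁆ ∈ lowerCentralSeries K F F (j + 1) := by
          rw [lowerCentralSeries_succ, ← lie_skew]
          exact neg_mem (LieSubmodule.lie_mem_lie (LieSubmodule.mem_top x) hy)
        have := h (j + 1) _ hyx
        rw [add_right_comm] at this
        exact bracketSpan_mono (by simp) _ this
      · exact bracketSpan_le _ _ (h j y hy)

theorem map_mem_lowerCentralSeries (f : F →ₗ⁅K⁆ L) {k : ℕ} {x : F}
    (hx : x ∈ lowerCentralSeries K F F k) : f x ∈ lowerCentralSeries K L L k :=
  LieIdeal.map_lowerCentralSeries_le k (LieIdeal.mem_map hx)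

theorem exists_mem_lowerCentralSeries {f : F →ₗ⁅K⁆ L} (hf : Function.Surjective f) {k : ℕ} {y : L}
    (hy : y ∈ lowerCentralSeries K L L k) : ∃ x ∈ lowerCentralSeries K F F k, f x = y := by
  rw [← LieIdeal.lowerCentralSeries_map_eq k hf] at hy
  obtain ⟨x, hx⟩ := LieIdeal.mem_map_of_surjective hf hy
  exact ⟨x, x.2, hx⟩

/-- Controlled elements span the k-th term, so if f killed all of them, the k-th term of L would
vanish. -/
theorem exists_controlled {f : F →ₗ⁅K⁆ L} (hf : Function.Surjective f) {k : ℕ}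
    (hk : lowerCentralSeries K L L k ≠ ⊥) :
    ∃ v ∈ lowerCentralSeries K F F k, f v ≠ 0 ∧ ∃ X : Finset F, X.card ≤ k + 1 ∧
      ∀ y : F, ⁅y, v⁆ ∈ bracketSpan K (X : Set F) k := by
  by_contra hcon
  refine hk ((LieSubmodule.eq_bot_iff _).2 fun y hy => ?_)
  obtain ⟨x, hx, rfl⟩ := exists_mem_lowerCentralSeries hf hy
  refine (Submodule.span_le (p := LinearMap.ker (f : F →ₗ[K] L))).2 ?_
    (lowerCentralSeries_le_span_controlled k hx)
  rintro v ⟨hv, X, hX, h⟩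
  by_contra hfv
  refine hcon ⟨v, hv, hfv, X, hX, fun y => ?_⟩
  simpa using h 0 y (LieSubmodule.mem_top y)

theorem nilpotencyLength_le_iff [LieRing.IsNilpotent L] (k : ℕ) :
    nilpotencyLength L L ≤ k ↔ lowerCentralSeries K L L k = ⊥ := by
  rcases h : nilpotencyLength L L with - | j
  · rw [nilpotencyLength_eq_zero_iff] at h
    simp only [zero_le, true_iff]
    exact (LieSubmodule.eq_bot_iff _).2 fun _ _ => Subsingleton.elim _ _
  · rw [nilpotencyLength_eq_succ_iff K] at h
    constructor
    · intro hjk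
      exact le_bot_iff.1 (h.1 ▸ antitone_lowerCentralSeries K L L hjk)
    · intro hk
      by_contra hlt
      exact h.2 (le_bot_iff.1 (hk ▸ antitone_lowerCentralSeries K L L (by omega)))

/-- If c' is the class of L', the c'-th term of L maps to 0, so it lies in the central kernel and
the next term vanishes. -/
theorem nilpotencyLength_of_central_extension [LieRing.IsNilpotent L] [LieRing.IsNilpotent L']
    {p : L →ₗ⁅K⁆ L'} (hp : Function.Surjective p) (hI : p.ker ≤ LieAlgebra.center K L) :
    nilpotencyLength L L = nilpotencyLength L' L' ∨
      nilpotencyLength L L = nilpotencyLength L' L' + 1 ∧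
        lowerCentralSeries K L L (nilpotencyLength L' L') ≤ p.ker := by
  have hle : nilpotencyLength L' L' ≤ nilpotencyLength L L := by
    rw [nilpotencyLength_le_iff (K := K), ← LieIdeal.lowerCentralSeries_map_eq _ hp,
      (nilpotencyLength_le_iff _).1 le_rfl]
    simp
  have hker : lowerCentralSeries K L L (nilpotencyLength L' L') ≤ p.ker := by
    intro x hx
    have := map_mem_lowerCentralSeries p hx
    rw [(nilpotencyLength_le_iff _).1 le_rfl, LieSubmodule.mem_bot] at this
    exact LieHom.mem_ker.2 this
  have hge : nilpotencyLength L L ≤ nilpotencyLength L' L' + 1 := by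
    rw [nilpotencyLength_le_iff (K := K), lowerCentralSeries_succ, LieSubmodule.lie_eq_bot_iff]
    intro x _ y hy
    exact (mem_maxTrivSubmodule K L L y).1 (hI (hker hy)) x
  by_cases h : nilpotencyLength L L = nilpotencyLength L' L'
  · exact Or.inl h
  · exact Or.inr ⟨by omega, hker⟩

end LowerCentralSeries

/-! ### One-dimensional central extensions and generators of [S,F]/[R,F] -/

section CentralExtension

variable {K F L L' : Type*} [Field K] [LieRing F] [LieAlgebra K F] [LieRing L] [LieAlgebra K L]
  [LieRing L'] [LieAlgebra K L'] {f : F →ₗ⁅K⁆ L} {p : L →ₗ⁅K⁆ L'}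

theorem mem_ker_comp {x : F} : x ∈ (p.comp f).ker ↔ f x ∈ p.ker := by
  simp only [LieHom.mem_ker, LieHom.comp_apply]

theorem lie_mem_ker_of_central (hI : p.ker ≤ LieAlgebra.center K L) {x : F}
    (hx : x ∈ (p.comp f).ker) (y : F) : ⁅x, y⁆ ∈ f.ker := by
  have h := (mem_maxTrivSubmodule K L L _).1 (hI (mem_ker_comp.1 hx)) (f y)
  rw [LieHom.mem_ker, LieHom.map_lie, ← lie_skew, h, neg_zero]

/-- If `I = S / R` is a one-dimensional ideal contained in the centre and in the derived
subalgebra, then `dim M(L) + 1 = dim M(L / I) + dim [S, F] / [R, F]`. -/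
theorem Multiplier.finrank_add_one_le {ι : Type*} [Fintype ι] (hf : Function.Surjective f)
    (hI : p.ker ≤ LieAlgebra.center K L) (hI' : p.ker ≤ derivedIdeal K L)
    (hI1 : Module.finrank K p.ker = 1) (v : ι → F)
    (hv : ⁅(p.comp f).ker, (⊤ : LieIdeal K F)⁆.toSubmodule ≤
      ⁅f.ker, (⊤ : LieIdeal K F)⁆.toSubmodule ⊔ Submodule.span K (Set.range v)) :
    (Module.Finite K (Multiplier f) ↔ Module.Finite K (Multiplier (p.comp f))) ∧
      (Module.Finite K (Multiplier f) → Module.finrank K (Multiplier f) + 1 ≤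
        Module.finrank K (Multiplier (p.comp f)) + Fintype.card ι) := by
  -- The chain A ≤ B ≤ C ≤ D is [R,F] ≤ [S,F] ≤ R ∩ F² ≤ S ∩ F²; computing dim D/A through B and
  -- through C gives the result.
  set A := ⁅f.ker, (⊤ : LieIdeal K F)⁆.toSubmodule
  set B := ⁅(p.comp f).ker, (⊤ : LieIdeal K F)⁆.toSubmodule
  set C := (f.ker ⊓ derivedIdeal K F).toSubmodule with hC
  set D := ((p.comp f).ker ⊓ derivedIdeal K F).toSubmodule with hD
  have hker : f.ker ≤ (p.comp f).ker := fun x hx => by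
    rw [mem_ker_comp, LieHom.mem_ker.1 hx]
    exact zero_mem _
  have hAB : A ≤ B := LieSubmodule.mono_lie_left (⊤ : LieIdeal K F) hker
  have hBC : B ≤ C := lie_top_le_of_forall fun x hx y =>
    ⟨lie_mem_ker_of_central hI hx y, lie_mem_derivedIdeal x y⟩
  have hCD : C ≤ D := fun x hx => ⟨hker hx.1, hx.2⟩
  have hCker : C = LinearMap.ker (f : F →ₗ[K] L) ⊓ D := by
    ext x
    exact ⟨fun hx => ⟨hx.1, hCD hx⟩, fun hx => ⟨hx.1, hx.2.2⟩⟩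
  obtain ⟨e⟩ := Subquotient.finrank_comap (P := D) (Q := p.ker.toSubmodule) (f : F →ₗ[K] L)
    (fun x hx => mem_ker_comp.1 hx.1) (fun y hy => by
      obtain ⟨x, hx, rfl⟩ := exists_mem_derivedIdeal hf (hI' hy)
      exact ⟨x, ⟨mem_ker_comp.2 hy, hx⟩, rfl⟩)
  rw [← hCker] at e
  have : Module.Finite K p.ker.toSubmodule := Module.finite_of_finrank_eq_succ hI1
  have finDC : Module.Finite K (Subquotient D C) := Module.Finite.equiv e.symm
  have hDC : Module.finrank K (Subquotient D C) = 1 := e.finrank_eq.trans hI1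
  obtain ⟨finBA, hBA⟩ := Subquotient.finite_and_finrank_le v hv
  -- `finrank` is 0 on infinite-dimensional spaces, so finiteness is carried along with each
  -- dimension.
  have hiff : Module.Finite K (Subquotient C A) ↔ Module.Finite K (Subquotient D B) := by
    have h₁ := Subquotient.finite_iff (hAB.trans hBC) hCD
    have h₂ := Subquotient.finite_iff hAB (hBC.trans hCD)
    tauto
  refine ⟨hiff, fun h => ?_⟩
  have : Module.Finite K (Subquotient D A) :=
    (Subquotient.finite_iff (hAB.trans hBC) hCD).2 ⟨finDC, h⟩
  have h₁ := Subquotient.finrank_add (hAB.trans hBC) hCD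
  have h₂ := Subquotient.finrank_add hAB (hBC.trans hCD)
  change Module.finrank K (Subquotient C A) + 1 ≤ Module.finrank K (Subquotient D B) + _
  omega

theorem exists_smul_add_of_mem_ker_comp (hI1 : Module.finrank K p.ker = 1) {z : F}
    (hz : f z ∈ p.ker) (hz0 : f z ≠ 0) {s : F} (hs : f s ∈ p.ker) :
    ∃ a : K, ∃ r ∈ f.ker, s = a • z + r := by
  obtain ⟨a, ha⟩ := (finrank_eq_one_iff_of_nonzero' (⟨f z, hz⟩ : p.ker)
    (fun h => hz0 (congrArg Subtype.val h))).1 hI1 ⟨f s, hs⟩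
  have ha : a • f z = f s := congrArg Subtype.val ha
  refine ⟨a, s - a • z, ?_, (add_sub_cancel _ _).symm⟩
  rw [LieHom.mem_ker, map_sub, map_smul, ha, sub_self]

/-- S = Kz + R, so modulo [R,F] only brackets with z matter. -/
theorem lie_ker_comp_le (hI1 : Module.finrank K p.ker = 1) {z : F}
    (hz : f z ∈ p.ker) (hz0 : f z ≠ 0) {P : Submodule K F}
    (hP : ⁅f.ker, (⊤ : LieIdeal K F)⁆.toSubmodule ≤ P) (h : ∀ y : F, ⁅z, y⁆ ∈ P) :
    ⁅(p.comp f).ker, (⊤ : LieIdeal K F)⁆.toSubmodule ≤ P := by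
  refine lie_top_le_of_forall fun s hs y => ?_
  obtain ⟨a, r, hr, rfl⟩ := exists_smul_add_of_mem_ker_comp hI1 hz hz0 (mem_ker_comp.1 hs)
  rw [add_lie, smul_lie]
  exact P.add_mem (P.smul_mem a (h y)) (hP (lie_mem_lie_top hr y))

theorem exists_ne_zero_of_finrank_eq_one (hf : Function.Surjective f)
    (hI1 : Module.finrank K p.ker = 1) : ∃ z : F, f z ∈ p.ker ∧ f z ≠ 0 := by
  obtain ⟨⟨y, hy⟩, hy0, -⟩ := finrank_eq_one_iff'.1 hI1
  obtain ⟨z, rfl⟩ := hf y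
  exact ⟨z, hy, fun h => hy0 (Subtype.ext h)⟩

/-- Centrality of I gives [S,F] ≤ R, and then Jacobi gives [z,F²] ≤ [R,F]. So [z,y] modulo [R,F]
depends only on the image of y in L/L². -/
theorem exists_span_lie_ker_of_abelianization [FiniteDimensional K L]
    (hf : Function.Surjective f) (hI : p.ker ≤ LieAlgebra.center K L)
    (hI1 : Module.finrank K p.ker = 1) :
    ∃ v : Fin (Module.finrank K L - Module.finrank K (derivedIdeal K L)) → F,
      ⁅(p.comp f).ker, (⊤ : LieIdeal K F)⁆.toSubmodule ≤
        ⁅f.ker, (⊤ : LieIdeal K F)⁆.toSubmodule ⊔ Submodule.span K (Set.range v) := by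
  obtain ⟨z, hz, hz0⟩ := exists_ne_zero_of_finrank_eq_one hf hI1
  have hd : Module.finrank K (L ⧸ (derivedIdeal K L).toSubmodule) =
      Module.finrank K L - Module.finrank K (derivedIdeal K L) :=
    Submodule.finrank_quotient _
  rw [← hd]
  let b := Module.finBasis K (L ⧸ (derivedIdeal K L).toSubmodule)
  let g : F →ₗ[K] L ⧸ (derivedIdeal K L).toSubmodule :=
    (derivedIdeal K L).toSubmodule.mkQ ∘ₗ (f : F →ₗ[K] L)
  have hg : Function.Surjective g := (Submodule.mkQ_surjective _).comp hf
  choose u hu using fun i => hg (b i)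
  refine ⟨fun i => ⁅z, u i⁆, lie_ker_comp_le hI1 hz hz0 le_sup_left fun y => ?_⟩
  have hzS : z ∈ (p.comp f).ker := mem_ker_comp.2 hz
  have hder : ∀ w ∈ derivedIdeal K F, ⁅z, w⁆ ∈ ⁅f.ker, (⊤ : LieIdeal K F)⁆ := by
    intro w hw
    refine derivedIdeal_le_of_forall (P := ⁅f.ker, (⊤ : LieIdeal K F)⁆.toSubmodule.comap
      (LieAlgebra.ad K F z : F →ₗ[K] F)) (fun x y => ?_) hw
    change ⁅z, ⁅x, y⁆⁆ ∈ ⁅f.ker, (⊤ : LieIdeal K F)⁆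
    rw [leibniz_lie]
    exact add_mem (lie_mem_lie_top (lie_mem_ker_of_central hI hzS x) y)
      (lie_mem_lie_top' (lie_mem_ker_of_central hI hzS y) x)
  have hy : g y ∈ (Submodule.span K (Set.range u)).map g := by
    rw [Submodule.map_span, ← Set.range_comp]
    have h : ⇑g ∘ u = b := funext hu
    rw [h, b.span_eq]
    trivial
  obtain ⟨x, hx, hxy⟩ := hy
  have hdiff : f (y - x) ∈ derivedIdeal K L := by
    rw [map_sub]
    exact (Submodule.Quotient.eq _).1 hxy.symm
  obtain ⟨w, hw, hwf⟩ := exists_mem_derivedIdeal hf hdiff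
  have hr : y - x - w ∈ f.ker := by rw [LieHom.mem_ker, map_sub, hwf, sub_self]
  have hsplit : ⁅z, y⁆ = (⁅z, y - x - w⁆ + ⁅z, w⁆) + ⁅z, x⁆ := by
    rw [← lie_add, ← lie_add]
    congr 1
    abel
  rw [hsplit]
  refine Submodule.add_mem_sup (add_mem (lie_mem_lie_top' hr z) (hder w hw)) ?_
  refine (Submodule.span_le (p := Submodule.comap (LieAlgebra.ad K F z : F →ₗ[K] F)
    (Submodule.span K _))).2 ?_ hx
  rintro _ ⟨i, rfl⟩
  exact Submodule.subset_span ⟨i, rfl⟩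

/-- Take z controlled by X. Each w in the k-th term of F maps into the line I, so w is a multiple of
z modulo R; the brackets ⁅x, w⁆ controlling ⁅y, z⁆ thus reduce to multiples of ⁅x, z⁆ with x in X.
-/
theorem exists_span_lie_ker_of_lowerCentralSeries (hf : Function.Surjective f)
    (hI1 : Module.finrank K p.ker = 1) {k : ℕ} (hk : lowerCentralSeries K L L k ≠ ⊥)
    (hkI : lowerCentralSeries K L L k ≤ p.ker) :
    ∃ X : Finset F, ∃ v : X → F, X.card ≤ k + 1 ∧
      ⁅(p.comp f).ker, (⊤ : LieIdeal K F)⁆.toSubmodule ≤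
        ⁅f.ker, (⊤ : LieIdeal K F)⁆.toSubmodule ⊔ Submodule.span K (Set.range v) := by
  obtain ⟨z, hzk, hz0, X, hX, h⟩ := exists_controlled hf hk
  have hmem : ∀ w ∈ lowerCentralSeries K F F k, f w ∈ p.ker := fun w hw =>
    hkI (map_mem_lowerCentralSeries f hw)
  refine ⟨X, fun x => ⁅(x : F), z⁆, hX, lie_ker_comp_le hI1 (hmem z hzk) hz0 le_sup_left
    fun y => ?_⟩
  rw [← lie_skew]
  refine Submodule.neg_mem _ (Submodule.span_le.2 ?_ (h y))
  rintro _ ⟨x, hx, w, hw, rfl⟩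
  obtain ⟨a, r, hr, rfl⟩ := exists_smul_add_of_mem_ker_comp hI1 (hmem z hzk) hz0 (hmem w hw)
  rw [lie_add, lie_smul, add_comm]
  exact Submodule.add_mem_sup (lie_mem_lie_top' hr x)
    (Submodule.smul_mem _ a (Submodule.subset_span ⟨⟨x, hx⟩, rfl⟩))

end CentralExtension

/-! ### Increments of Rai's bound and monotonicity of the defect -/

section RaiBound

/-- The difference n - m is unchanged, so the sum is too, and only the quadratic term moves. -/
theorem raiBound_succ_succ (n m c : ℕ) :
    raiBound (n + 1) (m + 1) c = raiBound n m c + ((n : ℚ) - m - 1) := by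
  simp only [raiBound, Nat.add_sub_add_right]
  push_cast
  simp only [add_sub_add_right_eq_sub]
  ring

theorem raiBound_class_succ_of_lt {n m c : ℕ} (h : n - m < c + 1) :
    raiBound n m (c + 1) = raiBound n m c := by
  simp only [raiBound]
  rw [min_eq_left (by omega), min_eq_left (by omega)]

/-- The sum gains the single term i = c + 1; it starts at 2, whence `1 ≤ c`. -/
theorem raiBound_class_succ_of_le {n m c : ℕ} (hc : 1 ≤ c) (h : c + 1 ≤ n - m) :
    raiBound n m (c + 1) = raiBound n m c - ((n : ℚ) - m - (c + 1)) := by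
  simp only [raiBound]
  rw [min_eq_right h, min_eq_right (by omega), Finset.sum_Icc_succ_top (by omega)]
  push_cast
  ring

theorem raiBound_zero_of_class_le_one (n : ℕ) {c : ℕ} (hc : c ≤ 1) :
    raiBound n 0 c = 1 / 2 * ((n : ℚ) - 1) * n := by
  rw [raiBound, Finset.Icc_eq_empty (by omega), Finset.sum_empty]
  push_cast
  ring

/-- Rai's bound for the dimension of the Schur multiplier of the Lie algebra `L`. -/
noncomputable def LieAlgebra.raiBound (K L : Type*) [Field K] [LieRing L] [LieAlgebra K L] : ℚ :=
  _root_.raiBound (Module.finrank K L) (Module.finrank K (derivedIdeal K L)) (nilpotencyLength L L)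

variable {K L L' : Type*} [Field K] [LieRing L] [LieAlgebra K L] [LieRing L'] [LieAlgebra K L']

theorem finrank_of_surjective_of_ker [FiniteDimensional K L] {p : L →ₗ⁅K⁆ L'}
    (hp : Function.Surjective p) (hI1 : Module.finrank K p.ker = 1) :
    Module.finrank K L = Module.finrank K L' + 1 := by
  have h := LinearMap.finrank_range_add_finrank_ker (p : L →ₗ[K] L')
  rw [LinearMap.range_eq_top.2 hp, finrank_top] at h
  rw [← h]
  exact congrArg _ hI1

theorem finrank_derivedIdeal_of_surjective_of_ker [FiniteDimensional K L] {p : L →ₗ⁅K⁆ L'}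
    (hp : Function.Surjective p) (hI : p.ker ≤ derivedIdeal K L)
    (hI1 : Module.finrank K p.ker = 1) :
    Module.finrank K (derivedIdeal K L) = Module.finrank K (derivedIdeal K L') + 1 := by
  have hmem : ∀ x ∈ (derivedIdeal K L).toSubmodule,
      (p : L →ₗ[K] L') x ∈ (derivedIdeal K L').toSubmodule := fun x hx => map_mem_derivedIdeal p hx
  obtain ⟨e⟩ := Subquotient.finrank_comap (p : L →ₗ[K] L') hmem
    (fun y hy => exists_mem_derivedIdeal hp hy)
  have hk : LinearMap.ker (p : L →ₗ[K] L') ⊓ (derivedIdeal K L).toSubmodule = p.ker.toSubmodule :=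
    inf_eq_left.2 hI
  rw [hk] at e
  have h := Submodule.finrank_quotient_add_finrank
    (p.ker.toSubmodule.submoduleOf (derivedIdeal K L).toSubmodule)
  rw [e.finrank_eq, (Submodule.submoduleOfEquivOfLe (show p.ker.toSubmodule ≤
    (derivedIdeal K L).toSubmodule from hI)).finrank_eq] at h
  rw [show Module.finrank K p.ker.toSubmodule = 1 from hI1] at h
  exact h.symm

/-- The estimate by n - m suffices unless the class rises and the sum gains a term; there the
estimate by the class of L replaces it. -/
theorem SchurMultiplier.central_extension [FiniteDimensional K L] [LieRing.IsNilpotent L]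
    [LieRing.IsNilpotent L'] {p : L →ₗ⁅K⁆ L'} (hp : Function.Surjective p)
    (hI : p.ker ≤ LieAlgebra.center K L) (hI' : p.ker ≤ derivedIdeal K L)
    (hI1 : Module.finrank K p.ker = 1) (hc : 2 ≤ nilpotencyLength L L) :
    (Module.Finite K (SchurMultiplier K L) ↔ Module.Finite K (SchurMultiplier K L')) ∧
      (Module.Finite K (SchurMultiplier K L) →
        (Module.finrank K (SchurMultiplier K L) : ℚ) - LieAlgebra.raiBound K L ≤
          Module.finrank K (SchurMultiplier K L') - LieAlgebra.raiBound K L') := by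
  have hf := freePresentation_surjective K L
  obtain ⟨e⟩ := SchurMultiplier.nonempty_linearEquiv (f := p.comp (freePresentation K L))
    (hp.comp hf)
  have hn := finrank_of_surjective_of_ker hp hI1
  have hm := finrank_derivedIdeal_of_surjective_of_ker hp hI' hI1
  have hmn : Module.finrank K (derivedIdeal K L) ≤ Module.finrank K L :=
    Submodule.finrank_le (derivedIdeal K L).toSubmodule
  obtain ⟨v, hv⟩ := exists_span_lie_ker_of_abelianization hf hI hI1
  obtain ⟨hiff, hd⟩ := Multiplier.finrank_add_one_le hf hI hI' hI1 v hv
  rw [Fintype.card_fin, e.finrank_eq] at hd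
  refine ⟨hiff.trans (Module.Finite.equiv_iff e), fun hfin => ?_⟩
  have hd : Module.finrank K (SchurMultiplier K L) + 1 ≤ _ := hd hfin
  have hdq : (Module.finrank K (SchurMultiplier K L) : ℚ) + 1 ≤
      Module.finrank K (SchurMultiplier K L') +
        ((Module.finrank K L : ℚ) - Module.finrank K (derivedIdeal K L)) := by
    rw [← Nat.cast_sub hmn]
    exact_mod_cast hd
  unfold LieAlgebra.raiBound
  rw [hn, hm, raiBound_succ_succ]
  rw [hn, hm] at hdq hmn
  push_cast at hdq
  rcases nilpotencyLength_of_central_extension hp hI with h | ⟨h, hker⟩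
  · rw [h]
    linarith
  · rcases lt_or_ge (Module.finrank K L' - Module.finrank K (derivedIdeal K L'))
      (nilpotencyLength L' L' + 1) with hlt | hle
    · rw [h, raiBound_class_succ_of_lt hlt]
      linarith
    · have hne : lowerCentralSeries K L L (nilpotencyLength L' L') ≠ ⊥ := by
        rw [ne_eq, ← nilpotencyLength_le_iff]
        omega
      obtain ⟨X, w, hX, hw⟩ := exists_span_lie_ker_of_lowerCentralSeries hf hI1 hne hker
      have hcl := (Multiplier.finrank_add_one_le hf hI hI' hI1 w hw).2 hfin
      rw [Fintype.card_coe, e.finrank_eq] at hcl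
      have hcl : Module.finrank K (SchurMultiplier K L) + 1 ≤
          Module.finrank K (SchurMultiplier K L') + (nilpotencyLength L' L' + 1) :=
        le_trans hcl (by omega)
      have hclq : (Module.finrank K (SchurMultiplier K L) : ℚ) + 1 ≤
          Module.finrank K (SchurMultiplier K L') + (nilpotencyLength L' L' + 1) := by
        exact_mod_cast hcl
      rw [h, raiBound_class_succ_of_le (by omega) hle]
      linarith

/-- The quotient map of a Lie algebra by an ideal, as a homomorphism of Lie algebras. -/
def LieIdeal.quotientHom (I : LieIdeal K L) : L →ₗ⁅K⁆ L ⧸ I :=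
  { LieSubmodule.Quotient.mk' I with
    map_lie' := fun {x y} => LieSubmodule.Quotient.mk_bracket I x y }

theorem LieIdeal.quotientHom_surjective (I : LieIdeal K L) : Function.Surjective I.quotientHom :=
  LieSubmodule.Quotient.surjective_mk' I

theorem LieIdeal.ker_quotientHom (I : LieIdeal K L) : I.quotientHom.ker = I := by
  ext x
  rw [LieHom.mem_ker]
  exact LieSubmodule.Quotient.mk_eq_zero (N := I)

theorem LieIdeal.isNilpotent_quotient [LieRing.IsNilpotent L] (I : LieIdeal K L) :
    LieRing.IsNilpotent (L ⧸ I) :=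
  I.quotientHom_surjective.lieAlgebra_isNilpotent

theorem LieIdeal.exists_finrank_eq_one_le {J : LieIdeal K L} (hJ : J ≠ ⊥)
    (hJc : J ≤ LieAlgebra.center K L) : ∃ I : LieIdeal K L, I ≤ J ∧ Module.finrank K I = 1 := by
  obtain ⟨z, hz, hz0⟩ := Submodule.exists_mem_ne_zero_of_ne_bot
    (mt (LieSubmodule.toSubmodule_eq_bot J).1 hJ)
  have hzl : ∀ x : L, ⁅x, z⁆ = 0 := (mem_maxTrivSubmodule K L L z).1 (hJc hz)
  let I : LieIdeal K L :=
    { Submodule.span K {z} with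
      lie_mem := by
        intro x y hy
        obtain ⟨a, rfl⟩ := Submodule.mem_span_singleton.1 hy
        rw [lie_smul, hzl, smul_zero]
        exact Submodule.zero_mem _ }
  refine ⟨I, fun y hy => ?_, finrank_span_singleton hz0⟩
  obtain ⟨a, rfl⟩ := Submodule.mem_span_singleton.1 (show y ∈ Submodule.span K {z} from hy)
  exact J.smul_mem a hz

theorem derivedIdeal_eq_lowerCentralSeries : derivedIdeal K L = lowerCentralSeries K L L 1 := by
  rw [lowerCentralSeries_succ]
  rfl

end RaiBound

/-! ### Rai's bound and algebras attaining it -/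

theorem SchurMultiplier.finrank_le_raiBound_of_isLieAbelian {K L : Type*} [Field K] [LieRing L]
    [LieAlgebra K L] [FiniteDimensional K L] [LieRing.IsNilpotent L] [IsLieAbelian L] :
    Module.Finite K (SchurMultiplier K L) ∧
      (Module.finrank K (SchurMultiplier K L) : ℚ) ≤ LieAlgebra.raiBound K L := by
  obtain ⟨h₁, h₂⟩ := Multiplier.finrank_le_of_abelian (freePresentation_surjective K L)
  refine ⟨h₁, ?_⟩
  have hbot : lowerCentralSeries K L L 1 = ⊥ := by
    rwa [← trivial_iff_lower_central_eq_bot]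
  have hc : nilpotencyLength L L ≤ 1 := (nilpotencyLength_le_iff (K := K) 1).2 hbot
  have hm : Module.finrank K (derivedIdeal K L) = 0 := by
    rw [derivedIdeal_eq_lowerCentralSeries, hbot]
    exact finrank_bot K L
  rw [LieAlgebra.raiBound, hm, raiBound_zero_of_class_le_one _ hc]
  refine (Nat.cast_le.2 h₂).trans (Nat.cast_div_le.trans_eq ?_)
  -- The subtraction in n(n-1) is truncated, so n = 0 is treated apart.
  rcases Module.finrank K L with - | n
  · simp
  · push_cast
    ring

/-- Rai's bound for the dimension of the Schur multiplier of a nilpotent Lie algebra. -/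
theorem SchurMultiplier.finrank_le_raiBound {K : Type*} [Field K] (N : ℕ) :
    ∀ (L : Type*) [LieRing L] [LieAlgebra K L] [FiniteDimensional K L] [LieRing.IsNilpotent L],
      Module.finrank K L = N → Module.Finite K (SchurMultiplier K L) ∧
        (Module.finrank K (SchurMultiplier K L) : ℚ) ≤ LieAlgebra.raiBound K L := by
  induction N with
  | zero =>
    intro L _ _ _ _ hN
    have : Subsingleton L := Module.finrank_zero_iff.1 hN
    have : IsLieAbelian L := ⟨fun _ _ => Subsingleton.elim _ _⟩
    exact finrank_le_raiBound_of_isLieAbelian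
  | succ N ih =>
    intro L _ _ _ _ hN
    rcases le_or_gt (nilpotencyLength L L) 1 with hc | hc
    · have : IsLieAbelian L := isTrivial_of_nilpotencyLength_le_one L L hc
      exact finrank_le_raiBound_of_isLieAbelian
    -- The last nonzero term of the lower central series is central, and lies in L² because k ≥ 1; a
    -- line in it serves as I.
    · obtain ⟨k, hk⟩ : ∃ k, nilpotencyLength L L = k + 1 := ⟨_, (Nat.sub_add_cancel hc.le).symm⟩
      have hk' := (nilpotencyLength_eq_succ_iff K L L k).1 hk
      have hcenter : lowerCentralSeries K L L k ≤ LieAlgebra.center K L := by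
        refine (le_max_triv_iff_bracket_eq_bot K L L).2 ?_
        rw [← lowerCentralSeries_succ]
        exact hk'.1
      obtain ⟨I, hI, hI1⟩ := LieIdeal.exists_finrank_eq_one_le hk'.2 hcenter
      have hder : I ≤ derivedIdeal K L := by
        rw [derivedIdeal_eq_lowerCentralSeries]
        exact hI.trans (antitone_lowerCentralSeries K L L (by omega))
      have := I.isNilpotent_quotient
      have hker := I.ker_quotientHom
      have hI1' : Module.finrank K I.quotientHom.ker = 1 := by rw [hker, hI1]
      have hn := finrank_of_surjective_of_ker I.quotientHom_surjective hI1'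
      obtain ⟨h₁, h₂⟩ := ih (L ⧸ I) (by omega)
      obtain ⟨h₃, h₄⟩ := central_extension I.quotientHom_surjective
        (hker.le.trans (hI.trans hcenter)) (hker.le.trans hder) hI1' hc
      have h₅ := h₃.2 h₁
      exact ⟨h₅, by linarith [h₄ h₅]⟩

theorem proposition23 {K L : Type*} [Field K] [LieRing L] [LieAlgebra K L]
    [FiniteDimensional K L] [LieRing.IsNilpotent L]
    (hc : 3 ≤ LieModule.nilpotencyLength L L)
    (hL : AttainsRaiBound K L)
    (I : LieIdeal K L) (hI : I ≤ LieAlgebra.center K L ⊓ derivedIdeal K L)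
    (hI1 : Module.finrank K I = 1) :
    AttainsRaiBound K (L ⧸ I) := by
  have := I.isNilpotent_quotient
  have hker := I.ker_quotientHom
  obtain ⟨h₁, h₂⟩ := SchurMultiplier.central_extension I.quotientHom_surjective
    (hker.le.trans (hI.trans inf_le_left)) (hker.le.trans (hI.trans inf_le_right))
    (by rw [hker, hI1]) (by omega)
  have hle := (SchurMultiplier.finrank_le_raiBound (K := K) _ (L ⧸ I) rfl).2
  have heq : (Module.finrank K (SchurMultiplier K L) : ℚ) = LieAlgebra.raiBound K L := hL.2
  have hge : LieAlgebra.raiBound K (L ⧸ I) ≤ Module.finrank K (SchurMultiplier K (L ⧸ I)) := by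
    linarith [h₂ hL.1]
  exact ⟨h₁.1 hL.1, le_antisymm hle hge⟩
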